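/- A $d$-polytope is the convex hull of a nonempty finite set of points whose affine hull has dimension $d$; its facets and ridges are its faces of dimension $d-1$ and $d-2$, respectively. A polytope is called super-Kirkman if any two distinct facets of it intersect in a ridge. Fix an integer $k\ge 7$. Then for all sufficiently large $d$ (depending on $k$) there is a super-Kirkman $d$-polytope with exactly $d+k$ vertices. -/

import Mathlib

namespace Polytope

variable {E : Type*} [NormedAddCommGroup E] [NormedSpace ℝ E]

/-- A (convex) polytope: the convex hull of a nonempty finite set of points. -/
def IsPolytope (P : Set E) : Prop :=
  ∃ s : Finset E, s.Nonempty ∧ P = convexHull ℝ (s : Set E)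

/-- The dimension of (the affine hull of) a nonempty set. -/
noncomputable def dim (P : Set E) : ℕ :=
  Module.finrank ℝ (vectorSpan ℝ P)

/-- A nonempty face of `P`: the set of maximizers over `P` of some linear functional. -/
def IsFace (P F : Set E) : Prop :=
  F.Nonempty ∧ IsExposed ℝ P F

/-- A facet of a `d`-polytope: a face of dimension `d - 1`. -/
def IsFacet (P F : Set E) : Prop :=
  IsFace P F ∧ dim F + 1 = dim P

/-- A ridge of a `d`-polytope: a face of dimension `d - 2`. -/
def IsRidge (P R : Set E) : Prop :=
  IsFace P R ∧ dim R + 2 = dim P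

/-- The vertices of `P`, i.e. its extreme points. -/
def vertices (P : Set E) : Set E :=
  P.extremePoints ℝ

/-- A polytope is super-Kirkman if any two distinct facets of it intersect in a ridge. -/
def IsSuperKirkman (P : Set E) : Prop :=
  IsPolytope P ∧
    ∀ F G : Set E, IsFacet P F → IsFacet P G → F ≠ G → IsRidge P (F ∩ G)

end Polytope

/-! A polytope is encoded by the cone over it, written as the nonnegative part of a subspace `L` of
coordinate space, with the coordinates as facet inequalities. The super-Kirkman property follows
from a condition on supports: for any set of at most two coordinates, every other coordinate is
nonzero on some ray vanishing on that set. Summing rays then gives points with exactly these zeros,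
so two facets meet in codimension two (`HasSmallZeros.isRidge_inter`). Slicing by coordinate sum 1
turns the cone into a polytope with one vertex per ray.

The excess, rays minus cone dimension, is additive under direct sums (`HasKirkmanCone.add`), and
adding a single ray (a pyramid) raises the dimension but keeps the excess. So one cone of each
excess `k - 1 ≥ 6` suffices. Products of an `a`- and a `b`-simplex with `a, b ≥ 2` have excess `a *
b`, giving 4, 6 and 9; two copies of excess 4 give 8; an explicit sporadic cone gives 7; adding 4
repeatedly reaches the rest. -/

namespace Polytope

/-! ### Kirkman cones -/

/-- The nonnegative part of the subspace `L` is a pointed cone whose extreme rays are spanned by the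
`v k`, whose facets are the coordinate hyperplanes, and any two of whose facets meet in a
codimension-two face. -/
structure IsKirkmanCone {ι κ : Type} (L : Submodule ℝ (ι → ℝ)) (v : κ → ι → ℝ) : Prop where
  mem : ∀ k, v k ∈ L
  nonneg : ∀ k i, 0 ≤ v k i
  ne_zero : ∀ k, v k ≠ 0
  antichain : ∀ k l, (∀ i, v k i ≠ 0 → v l i ≠ 0) → k = l
  exists_support_subset : ∀ x ∈ L, (∀ i, 0 ≤ x i) → x ≠ 0 → ∃ k, ∀ i, v k i ≠ 0 → x i ≠ 0
  exists_ray : ∀ s : Finset ι, s.card ≤ 2 → ∀ i ∉ s, ∃ k, (∀ j ∈ s, v k j = 0) ∧ v k i ≠ 0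

/-- Add up all rays vanishing on `s`: nothing cancels, and `exists_ray` makes every other coordinate
positive. -/
theorem IsKirkmanCone.exists_zeros {ι κ : Type} [Finite κ] {L : Submodule ℝ (ι → ℝ)}
    {v : κ → ι → ℝ} (h : IsKirkmanCone L v) (s : Finset ι) (hs : s.card ≤ 2) :
    ∃ x ∈ L, (∀ i, 0 ≤ x i) ∧ ∀ i, x i = 0 ↔ i ∈ s := by
  classical
  have := Fintype.ofFinite κ
  refine ⟨∑ k with ∀ j ∈ s, v k j = 0, v k, L.sum_mem fun k _ => h.mem k, fun i => ?_, fun i => ?_⟩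
  · rw [Finset.sum_apply]
    exact Finset.sum_nonneg fun k _ => h.nonneg k i
  · rw [Finset.sum_apply, Finset.sum_eq_zero_iff_of_nonneg fun k _ => h.nonneg k i]
    simp only [Finset.mem_filter, Finset.mem_univ, true_and]
    refine ⟨fun h0 => ?_, fun hi k hk => hk i hi⟩
    by_contra hi
    obtain ⟨k, hk, hki⟩ := h.exists_ray s hs i hi
    exact hki (h0 k hk)

/-! ### Moving inside a polyhedron -/

section Slice

variable {ι κ : Type}

/-- The polyhedron cut out of a real vector space by the inequalities `0 ≤ p i + φ u i`. -/
def slice {E : Type*} [AddCommGroup E] [Module ℝ E] (p : ι → ℝ) (φ : E →ₗ[ℝ] (ι → ℝ)) : Set E :=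
  {u | ∀ i, 0 ≤ p i + φ u i}

variable {E : Type*} [NormedAddCommGroup E] [NormedSpace ℝ E]

theorem convex_slice (p : ι → ℝ) (φ : E →ₗ[ℝ] (ι → ℝ)) : Convex ℝ (slice p φ) := by
  intro u hu w hw a b ha hb hab i
  have h1 := mul_nonneg ha (hu i)
  have h2 := mul_nonneg hb (hw i)
  have h3 : a * p i + b * p i = p i := by rw [← add_mul, hab, one_mul]
  simp only [map_add, map_smul, Pi.add_apply, Pi.smul_apply, smul_eq_mul]
  linarith

variable [Fintype ι]

/-- Subtract from `x` the largest multiple of `y` that keeps it nonnegative. -/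
theorem exists_sub_smul_nonneg {x y : ι → ℝ} (hx : ∀ i, 0 ≤ x i) (hy : ∀ i, 0 ≤ y i)
    (hy0 : y ≠ 0) (hxy : ∀ i, y i ≠ 0 → x i ≠ 0) :
    ∃ t : ℝ, 0 < t ∧ (∀ i, 0 ≤ x i - t * y i) ∧ ∃ j, y j ≠ 0 ∧ x j - t * y j = 0 := by
  classical
  obtain ⟨i₀, hi₀⟩ : ∃ i, y i ≠ 0 := by
    by_contra! h
    exact hy0 (funext h)
  obtain ⟨j, hj, hmin⟩ := Finset.exists_min_image (Finset.univ.filter fun i => y i ≠ 0)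
    (fun i => x i / y i) ⟨i₀, by simpa using hi₀⟩
  simp only [Finset.mem_filter, Finset.mem_univ, true_and] at hj hmin
  have hjpos : 0 < y j := lt_of_le_of_ne (hy j) (Ne.symm hj)
  refine ⟨x j / y j, div_pos (lt_of_le_of_ne (hx j) (hxy j hj).symm) hjpos, fun i => ?_, j, hj, ?_⟩
  · by_cases h : y i = 0
    · simpa [h] using hx i
    · have hipos : 0 < y i := lt_of_le_of_ne (hy i) (Ne.symm h)
      have := (le_div_iff₀ hipos).1 (hmin i h)
      linarith
  · field_simp
    ring

theorem sum_pos_of_nonneg_of_ne_zero {x : ι → ℝ} (hx : ∀ i, 0 ≤ x i) (h0 : x ≠ 0) :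
    0 < ∑ i, x i := by
  obtain ⟨i, hi⟩ := Function.ne_iff.1 h0
  exact Finset.sum_pos' (fun i _ => hx i) ⟨i, Finset.mem_univ _, lt_of_le_of_ne (hx i) (Ne.symm hi)⟩

/-- A nonnegative vector supported on the support of an extreme ray is a multiple of that ray. -/
theorem IsKirkmanCone.eq_smul_of_support_subset {L : Submodule ℝ (ι → ℝ)} {v : κ → ι → ℝ}
    (h : IsKirkmanCone L v) {y : ι → ℝ} (hyL : y ∈ L) (hy : ∀ i, 0 ≤ y i) (hy0 : y ≠ 0) {k : κ}
    (hs : ∀ i, y i ≠ 0 → v k i ≠ 0) : ∃ t : ℝ, v k = t • y := by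
  obtain ⟨t, -, htn, j, hj, hj0⟩ := exists_sub_smul_nonneg (h.nonneg k) hy hy0 hs
  refine ⟨t, ?_⟩
  -- A nonzero remainder would contain the support of some ray, which by the antichain condition is
  -- `k` itself; but the remainder vanishes at `j`, inside that support.
  by_contra hne
  obtain ⟨l, hl⟩ := h.exists_support_subset (v k - t • y) (L.sub_mem (h.mem k) (L.smul_mem t hyL))
    (fun i => by simpa using htn i) (sub_ne_zero.2 hne)
  have hlk : l = k := h.antichain l k fun i hi hk => by
    have h1 := hl i hi
    by_cases hyi : y i = 0
    · simp [hk, hyi] at h1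
    · exact hs i hyi hk
  subst hlk
  exact hl j (hs j hj) (by simpa using hj0)

/-- From a point of the slice, one can move slightly in every direction along which the vanishing
coordinates do not change. -/
theorem exists_pos_add_smul_mem_slice {p : ι → ℝ} {φ : E →ₗ[ℝ] (ι → ℝ)} {u w : E}
    (hu : u ∈ slice p φ) (hw : ∀ i, p i + φ u i = 0 → φ w i = 0) :
    ∃ ε : ℝ, 0 < ε ∧ u + ε • w ∈ slice p φ ∧ u - ε • w ∈ slice p φ := by
  have key : ∀ i, ∀ᶠ ε : ℝ in nhdsWithin 0 (Set.Ioi 0),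
      0 ≤ p i + φ (u + ε • w) i ∧ 0 ≤ p i + φ (u - ε • w) i := by
    intro i
    simp only [map_add, map_sub, map_smul, Pi.add_apply, Pi.sub_apply, Pi.smul_apply, smul_eq_mul]
    by_cases h : p i + φ u i = 0
    · refine Filter.Eventually.of_forall fun ε => ?_
      rw [hw i h]
      constructor <;> linarith
    · have hpos : 0 < p i + φ u i := lt_of_le_of_ne (hu i) (Ne.symm h)
      have c1 : ContinuousAt (fun ε : ℝ => p i + (φ u i + ε * φ w i)) 0 := by fun_prop
      have c2 : ContinuousAt (fun ε : ℝ => p i + (φ u i - ε * φ w i)) 0 := by fun_prop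
      have e1 := c1.eventually (lt_mem_nhds (a := 0) (by simpa using hpos))
      have e2 := c2.eventually (lt_mem_nhds (a := 0) (by simpa using hpos))
      filter_upwards [nhdsWithin_le_nhds e1, nhdsWithin_le_nhds e2] with ε h1 h2
      exact ⟨h1.le, h2.le⟩
  obtain ⟨ε, h1, h2⟩ := ((Filter.eventually_all.2 key).and self_mem_nhdsWithin).exists
  exact ⟨ε, h2, fun i => (h1 i).1, fun i => (h1 i).2⟩

end Slice

/-! ### Facets and ridges of a slice -/

section Faces

variable {ι : Type} {E : Type*} [NormedAddCommGroup E] [NormedSpace ℝ E]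
  {p : ι → ℝ} {φ : E →ₗ[ℝ] (ι → ℝ)}

/-- The directions along which the coordinates in `s` do not change. -/
def sliceDirections (φ : E →ₗ[ℝ] (ι → ℝ)) (s : Finset ι) : Submodule ℝ E where
  carrier := {w | ∀ i ∈ s, φ w i = 0}
  add_mem' ha hb i hi := by simp [ha i hi, hb i hi]
  zero_mem' i _ := by simp
  smul_mem' c x hx i hi := by simp [hx i hi]

/-- The face of the slice on which the coordinates in `s` vanish. -/
def sliceFace (p : ι → ℝ) (φ : E →ₗ[ℝ] (ι → ℝ)) (s : Finset ι) : Set E :=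
  {u | u ∈ slice p φ ∧ ∀ i ∈ s, p i + φ u i = 0}

/-- The point `u` is relatively interior to the face, so it can be moved a little in every
admissible direction. -/
theorem vectorSpan_sliceFace [Fintype ι] {s : Finset ι} {u : E} (hu : u ∈ slice p φ)
    (hs : ∀ i, p i + φ u i = 0 ↔ i ∈ s) :
    vectorSpan ℝ (sliceFace p φ s) = sliceDirections φ s := by
  apply le_antisymm
  · refine Submodule.span_le.2 ?_
    rintro _ ⟨a, ha, b, hb, rfl⟩ i hi
    have h1 := ha.2 i hi
    have h2 := hb.2 i hi
    simp only [vsub_eq_sub, map_sub, Pi.sub_apply]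
    linarith
  · intro w hw
    have hw' : ∀ i, p i + φ u i = 0 → φ w i = 0 := fun i hi => hw i ((hs i).1 hi)
    obtain ⟨ε, hε, h1, -⟩ := exists_pos_add_smul_mem_slice hu hw'
    have hmem : u + ε • w ∈ sliceFace p φ s := ⟨h1, fun i hi => by
      have := (hs i).2 hi
      simp only [map_add, map_smul, Pi.add_apply, Pi.smul_apply, smul_eq_mul, hw i hi]
      linarith⟩
    have hsub := vsub_mem_vectorSpan ℝ hmem (⟨hu, fun i hi => (hs i).2 hi⟩ : u ∈ sliceFace p φ s)
    rw [vsub_eq_sub, add_sub_cancel_left] at hsub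
    simpa [smul_smul, inv_mul_cancel₀ hε.ne'] using Submodule.smul_mem _ ε⁻¹ hsub

/-- The exposing functional is minus the sum of the coordinates in `s`. -/
theorem isExposed_sliceFace [FiniteDimensional ℝ E] (p : ι → ℝ) (φ : E →ₗ[ℝ] (ι → ℝ)) (s : Finset ι) :
    IsExposed ℝ (slice p φ) (sliceFace p φ s) := by
  rintro ⟨u₀, hu₀, hs₀⟩
  have hval : ∀ u, ∑ i ∈ s, φ u i = ∑ i ∈ s, (p i + φ u i) - ∑ i ∈ s, p i := fun u => by
    simp [Finset.sum_add_distrib]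
  let l : E →ₗ[ℝ] ℝ := -∑ i ∈ s, (LinearMap.proj i).comp φ
  have hl : ∀ u, l u = -∑ i ∈ s, φ u i := fun u => by simp [l, LinearMap.sum_apply]
  refine ⟨LinearMap.toContinuousLinearMap l, ?_⟩
  ext u
  simp only [sliceFace, Set.mem_ofPred_eq, LinearMap.coe_toContinuousLinearMap', hl, hval]
  refine and_congr_right fun hu => ⟨fun h w hw => ?_, fun h => ?_⟩
  · rw [Finset.sum_eq_zero h]
    have := Finset.sum_nonneg fun i (_ : i ∈ s) => hw i
    linarith
  · have h0 := h u₀ hu₀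
    rw [Finset.sum_eq_zero hs₀] at h0
    refine (Finset.sum_eq_zero_iff_of_nonneg fun i _ => hu i).1 (le_antisymm (by linarith) ?_)
    exact Finset.sum_nonneg fun i _ => hu i

theorem finrank_sliceDirections_empty :
    Module.finrank ℝ (sliceDirections φ ∅) = Module.finrank ℝ E := by
  have : sliceDirections φ ∅ = ⊤ := by
    ext w
    simp [sliceDirections]
  rw [this, finrank_top]

theorem dim_slice [Fintype ι] {u : E} (hu : u ∈ slice p φ) (h0 : ∀ i, p i + φ u i ≠ 0) :
    dim (slice p φ) = Module.finrank ℝ E := by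
  have : slice p φ = sliceFace p φ ∅ := by
    ext w
    simp [sliceFace]
  rw [dim, this, vectorSpan_sliceFace hu (by simpa using h0), finrank_sliceDirections_empty]

theorem finrank_sliceDirections_singleton [FiniteDimensional ℝ E] {i : ι} {w : E} (hw : φ w i ≠ 0) :
    Module.finrank ℝ (sliceDirections φ {i}) + 1 = Module.finrank ℝ E := by
  let f : E →ₗ[ℝ] ℝ := (LinearMap.proj i).comp φ
  have hker : sliceDirections φ {i} = LinearMap.ker f := by
    ext x
    simp [sliceDirections, f]
  have hsurj : Function.Surjective f := LinearMap.surjective (fun h => hw (LinearMap.congr_fun h w))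
  have := f.finrank_range_add_finrank_ker
  rw [LinearMap.range_eq_top.2 hsurj, finrank_top, Module.finrank_self] at this
  rw [hker]
  omega

theorem finrank_sliceDirections_pair [FiniteDimensional ℝ E] [DecidableEq ι] {i j : ι} {w w' : E} (hwi : φ w i ≠ 0)
    (hwj : φ w j = 0) (hwi' : φ w' i = 0) (hwj' : φ w' j ≠ 0) :
    Module.finrank ℝ (sliceDirections φ {i, j}) + 2 = Module.finrank ℝ E := by
  let f : E →ₗ[ℝ] ℝ × ℝ := ((LinearMap.proj i).comp φ).prod ((LinearMap.proj j).comp φ)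
  have hker : sliceDirections φ {i, j} = LinearMap.ker f := by
    ext x
    simp [sliceDirections, f]
  have hsurj : Function.Surjective f := by
    rintro ⟨a, b⟩
    refine ⟨(a / φ w i) • w + (b / φ w' j) • w', ?_⟩
    simp [f, hwj, hwi', hwi, hwj']
  have := f.finrank_range_add_finrank_ker
  rw [LinearMap.range_eq_top.2 hsurj, finrank_top, Module.finrank_prod, Module.finrank_self] at this
  rw [hker]
  omega

/-- A proper exposed face of a slice lies on a coordinate hyperplane. -/
theorem exists_forall_eq_zero_of_isExposed [Fintype ι] {F : Set E} (hF : IsExposed ℝ (slice p φ) F)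
    (hne : F.Nonempty) (hproper : F ≠ slice p φ) : ∃ i, ∀ u ∈ F, p i + φ u i = 0 := by
  by_contra! hcon
  choose u huF hu0 using hcon
  have hconv : Convex ℝ F := hF.convex (convex_slice p φ)
  obtain ⟨u₀, hu₀⟩ := hne
  have hsub : F ⊆ slice p φ := hF.subset
  -- Averaging points of `F` off each hyperplane gives an interior point `c` in `F`. A functional
  -- maximal at `c` is constant on the slice, as seen by stepping from `c` away from `w`.
  obtain ⟨c, hcF, hc⟩ : ∃ c ∈ F, ∀ i, p i + φ c i ≠ 0 := by
    have key : ∀ s : Finset ι, ∃ c ∈ F, ∀ i ∈ s, 0 < p i + φ c i := by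
      classical
      intro s
      induction s using Finset.induction_on with
      | empty => exact ⟨u₀, hu₀, by simp⟩
      | insert a s _ ih =>
        obtain ⟨c, hcF, hc⟩ := ih
        refine ⟨(1 / 2 : ℝ) • c + (1 / 2 : ℝ) • u a,
          hconv hcF (huF a) (by norm_num) (by norm_num) (by norm_num), fun i hi => ?_⟩
        have h1 := hsub hcF i
        have h2 := hsub (huF a) i
        simp only [map_add, map_smul, Pi.add_apply, Pi.smul_apply, smul_eq_mul]
        rcases Finset.mem_insert.1 hi with rfl | hi
        · have := lt_of_le_of_ne h2 (hu0 i).symm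
          linarith
        · have := hc i hi
          linarith
    obtain ⟨c, hcF, hc⟩ := key Finset.univ
    exact ⟨c, hcF, fun i => (hc i (Finset.mem_univ i)).ne'⟩
  obtain ⟨l, hl⟩ := hF ⟨u₀, hu₀⟩
  refine hproper (hsub.antisymm fun w hw => ?_)
  obtain ⟨ε, hε, -, h2⟩ := exists_pos_add_smul_mem_slice (w := w - c) (hsub hcF)
    fun i hi => absurd hi (hc i)
  have hcl : ∀ y ∈ slice p φ, l y ≤ l c := by
    rw [hl] at hcF
    exact hcF.2
  have h3 := hcl _ h2
  simp only [map_sub, map_smul, smul_eq_mul] at h3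
  have h4 : l c ≤ l w := by
    by_contra! h5
    have := mul_pos hε (sub_pos.2 h5)
    linarith
  rw [hl]
  exact ⟨hw, fun y hy => (hcl y hy).trans h4⟩

variable (p φ) in
/-- Every set of at most two coordinates is the set of vanishing coordinates of a point. -/
def HasSmallZeros : Prop :=
  ∀ s : Finset ι, s.card ≤ 2 → ∃ u ∈ slice p φ, ∀ i, p i + φ u i = 0 ↔ i ∈ s

theorem HasSmallZeros.exists_direction (h : HasSmallZeros p φ) {i j : ι} (hij : i ≠ j) :
    ∃ w, φ w i ≠ 0 ∧ φ w j = 0 := by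
  classical
  obtain ⟨u, -, hu⟩ := h {j} (by simp)
  obtain ⟨u', -, hu'⟩ := h {i, j} Finset.card_le_two
  have h1 := (hu i).not.2 (by simpa using hij)
  have h2 := (hu j).2 (by simp)
  have h3 := (hu' i).2 (by simp)
  have h4 := (hu' j).2 (by simp)
  refine ⟨u - u', ?_, ?_⟩
  · simp only [map_sub, Pi.sub_apply]
    intro h5
    exact h1 (by linarith)
  · simp only [map_sub, Pi.sub_apply]
    linarith

/-- Every facet of the slice is a coordinate facet. -/
theorem HasSmallZeros.eq_sliceFace_of_isFacet [Fintype ι] [FiniteDimensional ℝ E] (h : HasSmallZeros p φ) {F : Set E}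
    (hF : IsFacet (slice p φ) F) : ∃ i, F = sliceFace p φ {i} := by
  obtain ⟨c, hc, hc0⟩ := h ∅ (by simp)
  have hdim := dim_slice hc (by simpa using hc0)
  obtain ⟨⟨hne, hexp⟩, hFd⟩ := hF
  obtain ⟨i, hi⟩ := exists_forall_eq_zero_of_isExposed hexp hne fun hEq => by
    rw [hEq] at hFd
    omega
  obtain ⟨u, hu, hu0⟩ := h {i} (by simp)
  have hsub : F ⊆ sliceFace p φ {i} := fun x hx => ⟨hexp.subset hx, by simpa using hi x hx⟩
  have hspan := vectorSpan_sliceFace hu hu0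
  have hw : φ (c - u) i ≠ 0 := by
    have h1 := (hu0 i).2 (by simp)
    have h2 := (hc0 i).not.2 (by simp)
    simp only [map_sub, Pi.sub_apply]
    intro h5
    exact h2 (by linarith)
  have hrank := finrank_sliceDirections_singleton hw
  -- By equality of dimensions, the functional exposing `F` is constant on the whole coordinate
  -- face.
  have hspanEq : vectorSpan ℝ F = sliceDirections φ {i} := by
    refine Submodule.eq_of_le_of_finrank_eq (hspan ▸ vectorSpan_mono ℝ hsub) ?_
    have : Module.finrank ℝ (vectorSpan ℝ F) = dim F := rfl
    omega
  refine ⟨i, hsub.antisymm fun x hx => ?_⟩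
  obtain ⟨l, hl⟩ := hexp hne
  obtain ⟨y, hy⟩ := hne
  have hker : vectorSpan ℝ F ≤ LinearMap.ker (l : E →ₗ[ℝ] ℝ) := by
    refine Submodule.span_le.2 ?_
    rintro _ ⟨a, ha, b, hb, rfl⟩
    rw [hl] at ha hb
    have h1 := ha.2 b hb.1
    have h2 := hb.2 a ha.1
    simp only [vsub_eq_sub, SetLike.mem_coe, LinearMap.mem_ker, ContinuousLinearMap.coe_coe, map_sub]
    linarith
  have hmem : x - y ∈ sliceDirections φ {i} := by
    rw [← hspan]
    exact vsub_mem_vectorSpan ℝ hx (hsub hy)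
  rw [← hspanEq] at hmem
  have hxy := hker hmem
  simp only [LinearMap.mem_ker, ContinuousLinearMap.coe_coe, map_sub] at hxy
  rw [hl] at hy ⊢
  exact ⟨hx.1, fun z hz => by linarith [hy.2 z hz]⟩

theorem HasSmallZeros.isRidge_inter [Fintype ι] [FiniteDimensional ℝ E] (h : HasSmallZeros p φ) {F G : Set E}
    (hF : IsFacet (slice p φ) F) (hG : IsFacet (slice p φ) G) (hFG : F ≠ G) :
    IsRidge (slice p φ) (F ∩ G) := by
  classical
  obtain ⟨i, rfl⟩ := h.eq_sliceFace_of_isFacet hF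
  obtain ⟨j, rfl⟩ := h.eq_sliceFace_of_isFacet hG
  have hij : i ≠ j := by
    rintro rfl
    exact hFG rfl
  have hinter : sliceFace p φ {i} ∩ sliceFace p φ {j} = sliceFace p φ {i, j} := by
    ext x
    simp only [sliceFace, Set.mem_inter_iff, Set.mem_ofPred_eq, Finset.mem_singleton, forall_eq,
      Finset.mem_insert, forall_eq_or_imp]
    tauto
  rw [hinter]
  obtain ⟨c, hc, hc0⟩ := h ∅ (by simp)
  obtain ⟨u, hu, hu0⟩ := h {i, j} Finset.card_le_two
  obtain ⟨w, hwi, hwj⟩ := h.exists_direction hij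
  obtain ⟨w', hwj', hwi'⟩ := h.exists_direction hij.symm
  refine ⟨⟨⟨u, hu, fun k hk => (hu0 k).2 hk⟩, isExposed_sliceFace p φ _⟩, ?_⟩
  rw [dim_slice hc (by simpa using hc0), dim, vectorSpan_sliceFace hu hu0]
  exact finrank_sliceDirections_pair hwi hwj hwi' hwj'

end Faces

/-! ### From cone to polytope: compactness and vertices -/

section Vertices

variable {ι κ : Type} [Fintype ι] {E : Type*} [NormedAddCommGroup E] [NormedSpace ℝ E]
  {L : Submodule ℝ (ι → ℝ)} {v : κ → ι → ℝ} {p : ι → ℝ} {φ : E →ₗ[ℝ] (ι → ℝ)}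

/-- `u ↦ p + φ u` is an affine isomorphism onto the slice `∑ x = 1` of `L`. -/
structure IsSliceChart (L : Submodule ℝ (ι → ℝ)) (p : ι → ℝ) (φ : E →ₗ[ℝ] (ι → ℝ)) : Prop where
  injective : Function.Injective φ
  mem : ∀ u, p + φ u ∈ L
  sum_eq_one : ∀ u, ∑ i, (p i + φ u i) = 1
  surj : ∀ x ∈ L, ∑ i, x i = 1 → ∃ u, p + φ u = x

theorem IsSliceChart.isCompact_slice [FiniteDimensional ℝ E] (h : IsSliceChart L p φ) :
    IsCompact (slice p φ) := by
  have hemb : Topology.IsClosedEmbedding fun u => p + φ u :=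
    (Homeomorph.addLeft p).isClosedEmbedding.comp
      (LinearMap.isClosedEmbedding_of_injective (LinearMap.ker_eq_bot.2 h.injective))
  have : slice p φ = (fun u => p + φ u) ⁻¹' stdSimplex ℝ ι := by
    ext u
    exact ⟨fun hu => ⟨hu, h.sum_eq_one u⟩, fun hu => hu.1⟩
  rw [this]
  exact hemb.isCompact_preimage (isCompact_stdSimplex ℝ ι)

theorem IsKirkmanCone.hasSmallZeros [Finite κ] (hv : IsKirkmanCone L v) (h : IsSliceChart L p φ)
    (hcard : 2 < Fintype.card ι) : HasSmallZeros p φ := by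
  intro s hs
  obtain ⟨x, hxL, hx, hx0⟩ := hv.exists_zeros s hs
  -- More than two coordinates are needed here: otherwise `s` could be everything, and the zero
  -- vector cannot be normalized.
  have hne : x ≠ 0 := by
    rintro rfl
    have : s = Finset.univ := Finset.eq_univ_iff_forall.2 fun i => (hx0 i).1 rfl
    rw [this, Finset.card_univ] at hs
    omega
  have hpos := sum_pos_of_nonneg_of_ne_zero hx hne
  obtain ⟨u, hu⟩ := h.surj ((∑ i, x i)⁻¹ • x) (L.smul_mem _ hxL) (by
    simp [← Finset.mul_sum, inv_mul_cancel₀ hpos.ne'])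
  have hu' : ∀ i, p i + φ u i = (∑ i, x i)⁻¹ * x i := fun i => congrFun hu i
  refine ⟨u, fun i => ?_, fun i => ?_⟩
  · rw [hu' i]
    exact mul_nonneg (inv_nonneg.2 hpos.le) (hx i)
  · rw [hu' i, ← hx0 i]
    simp [hpos.ne']

/-- The points of the slice on the given rays. -/
theorem IsKirkmanCone.exists_vertex (hv : IsKirkmanCone L v) (h : IsSliceChart L p φ) (k : κ) :
    ∃ u, ∃ c : ℝ, 0 < c ∧ p + φ u = c • v k := by
  have hpos := sum_pos_of_nonneg_of_ne_zero (hv.nonneg k) (hv.ne_zero k)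
  obtain ⟨u, hu⟩ := h.surj ((∑ i, v k i)⁻¹ • v k) (L.smul_mem _ (hv.mem k)) (by
    simp [← Finset.mul_sum, inv_mul_cancel₀ hpos.ne'])
  exact ⟨u, _, inv_pos.2 hpos, hu⟩

theorem IsKirkmanCone.mem_extremePoints_slice (hv : IsKirkmanCone L v) (h : IsSliceChart L p φ)
    {k : κ} {u : E} {c : ℝ} (hc : 0 < c) (hu : p + φ u = c • v k) :
    u ∈ (slice p φ).extremePoints ℝ := by
  have hu' : ∀ i, p i + φ u i = c * v k i := fun i => congrFun hu i
  have hus : u ∈ slice p φ := fun i => by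
    rw [hu' i]
    exact mul_nonneg hc.le (hv.nonneg k i)
  -- The ray is the only point of the slice with support inside its own; both ends of a segment
  -- through `u` have such support.
  have key : ∀ y ∈ slice p φ, (∀ i, v k i = 0 → p i + φ y i = 0) → y = u := by
    intro y hy hs
    have hy0 : p + φ y ≠ 0 := fun h0 => by
      have := h.sum_eq_one y
      rw [Finset.sum_eq_zero fun i _ => by simpa using congrFun h0 i] at this
      exact zero_ne_one this
    obtain ⟨t, ht⟩ := hv.eq_smul_of_support_subset (h.mem y) hy hy0 fun i hi hki => hi (hs i hki)
    have ht' : ∀ i, p i + φ u i = c * t * (p i + φ y i) := fun i => by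
      rw [hu' i, ht]
      simp [mul_assoc]
    have hct : c * t = 1 := by
      have h1 := h.sum_eq_one u
      rw [Finset.sum_congr rfl fun i _ => ht' i, ← Finset.mul_sum, h.sum_eq_one y, mul_one] at h1
      exact h1
    apply h.injective
    funext i
    have := ht' i
    rw [hct] at this
    linarith
  refine mem_extremePoints.2 ⟨hus, fun y hy z hz hyz => ?_⟩
  obtain ⟨a, b, ha, hb, hab, rfl⟩ := hyz
  have hsum : ∀ i, a * (p i + φ y i) + b * (p i + φ z i) = c * v k i := fun i => by
    rw [← hu' i]
    simp only [map_add, map_smul, Pi.add_apply, Pi.smul_apply, smul_eq_mul]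
    linear_combination p i * hab
  constructor
  · refine key y hy fun i hi => ?_
    have h1 := hsum i
    rw [hi, mul_zero] at h1
    have h2 := mul_nonneg ha.le (hy i)
    have h3 := mul_nonneg hb.le (hz i)
    exact (mul_eq_zero.1 (le_antisymm (by linarith) h2)).resolve_left ha.ne'
  · refine key z hz fun i hi => ?_
    have h1 := hsum i
    rw [hi, mul_zero] at h1
    have h2 := mul_nonneg ha.le (hy i)
    have h3 := mul_nonneg hb.le (hz i)
    exact (mul_eq_zero.1 (le_antisymm (by linarith) h3)).resolve_left hb.ne'

/-- The support of `u` contains that of some ray, so `u` can move both towards and away from the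
vertex on that ray; extremality forces them to coincide. -/
theorem IsKirkmanCone.exists_of_mem_extremePoints (hv : IsKirkmanCone L v)
    (h : IsSliceChart L p φ) {f : κ → E} (hf : ∀ k, ∃ c : ℝ, 0 < c ∧ p + φ (f k) = c • v k)
    {u : E} (hu : u ∈ (slice p φ).extremePoints ℝ) : ∃ k, f k = u := by
  have hus := hu.1
  have hu0 : p + φ u ≠ 0 := fun h0 => by
    have := h.sum_eq_one u
    rw [Finset.sum_eq_zero fun i _ => by simpa using congrFun h0 i] at this
    exact zero_ne_one this
  obtain ⟨k, hk⟩ := hv.exists_support_subset _ (h.mem u) hus hu0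
  obtain ⟨c, hc, hck⟩ := hf k
  have hck' : ∀ i, p i + φ (f k) i = c * v k i := fun i => congrFun hck i
  obtain ⟨ε, hε, h1, h2⟩ := exists_pos_add_smul_mem_slice (w := f k - u) hus fun i hi => by
    have h3 : v k i = 0 := by
      by_contra h4
      exact hk i h4 hi
    have h5 := hck' i
    rw [h3, mul_zero] at h5
    simp only [map_sub, Pi.sub_apply]
    linarith
  refine ⟨k, ?_⟩
  have hmid : u ∈ openSegment ℝ (u + ε • (f k - u)) (u - ε • (f k - u)) := by
    refine ⟨1 / 2, 1 / 2, by norm_num, by norm_num, by norm_num, ?_⟩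
    module
  have := ((mem_extremePoints.1 hu).2 _ h1 _ h2 hmid).1
  have h3 : ε • (f k - u) = 0 := by simpa using this
  exact sub_eq_zero.1 ((smul_eq_zero.1 h3).resolve_left hε.ne')

/-- A slice of a Kirkman cone is a super-Kirkman polytope, with one vertex on each ray. -/
theorem IsKirkmanCone.isSuperKirkman_slice [Fintype κ] [FiniteDimensional ℝ E]
    (hv : IsKirkmanCone L v) (h : IsSliceChart L p φ) (hcard : 2 < Fintype.card ι) :
    IsSuperKirkman (slice p φ) ∧ dim (slice p φ) = Module.finrank ℝ E ∧
      (vertices (slice p φ)).ncard = Fintype.card κ := by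
  classical
  have hz := hv.hasSmallZeros h hcard
  obtain ⟨c, hc, hc0⟩ := hz ∅ (by simp)
  choose f hf using hv.exists_vertex h
  have hver : vertices (slice p φ) = Set.range f := by
    ext u
    refine ⟨fun hu => hv.exists_of_mem_extremePoints h hf hu, ?_⟩
    rintro ⟨k, rfl⟩
    obtain ⟨c, hc, hck⟩ := hf k
    exact hv.mem_extremePoints_slice h hc hck
  have hinj : Function.Injective f := by
    intro k l hkl
    obtain ⟨a, ha, hak⟩ := hf k
    obtain ⟨b, hb, hbl⟩ := hf l
    rw [hkl, hbl] at hak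
    refine hv.antichain k l fun i hi hl => ?_
    have := congrFun hak i
    simp only [Pi.smul_apply, smul_eq_mul, hl, mul_zero] at this
    exact mul_ne_zero ha.ne' hi this.symm
  have hhull : slice p φ = convexHull ℝ (Set.range f) := by
    -- Krein–Milman; the closure is superfluous as there are finitely many vertices.
    have hkm := closure_convexHull_extremePoints h.isCompact_slice (convex_slice p φ)
    have hfin : (Set.range f).Finite := Set.finite_range f
    rw [← hkm, show (slice p φ).extremePoints ℝ = Set.range f from hver,
      (hfin.isClosed_convexHull ℝ).closure_eq]
  refine ⟨⟨⟨Finset.univ.image f, ?_, by simpa using hhull⟩, fun F G hF hG hFG =>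
    hz.isRidge_inter hF hG hFG⟩, dim_slice hc (by simpa using hc0), ?_⟩
  · rw [Finset.image_nonempty, ← Finset.coe_nonempty, Finset.coe_univ, ← Set.nonempty_iff_univ_nonempty]
    by_contra hem
    rw [not_nonempty_iff] at hem
    rw [hhull, Set.range_eq_empty, convexHull_empty] at hc
    exact hc
  · rw [hver, ← Nat.card_coe_set_eq, Nat.card_range_of_injective hinj, Nat.card_eq_fintype_card]

theorem nonempty_linearEquiv_ker {V : Type*} [AddCommGroup V] [Module ℝ V] [FiniteDimensional ℝ V]
    (f : V →ₗ[ℝ] ℝ) (hf : Function.Surjective f) {d : ℕ} (hd : Module.finrank ℝ V = d + 1) :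
    Nonempty (EuclideanSpace ℝ (Fin d) ≃ₗ[ℝ] LinearMap.ker f) := by
  have hrank := f.finrank_range_add_finrank_ker
  rw [LinearMap.range_eq_top.2 hf, finrank_top, Module.finrank_self, hd] at hrank
  refine FiniteDimensional.nonempty_linearEquiv_of_finrank_eq ?_
  rw [finrank_euclideanSpace_fin]
  omega

/-- The directions are the kernel of the coordinate sum on `L`, based at a normalized positive
vector of `L`. -/
theorem IsKirkmanCone.exists_isSliceChart [Finite κ] (hv : IsKirkmanCone L v) (hcard : 0 < Fintype.card ι)
    {d : ℕ} (hd : Module.finrank ℝ L = d + 1) :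
    ∃ (p : ι → ℝ) (φ : EuclideanSpace ℝ (Fin d) →ₗ[ℝ] (ι → ℝ)), IsSliceChart L p φ := by
  obtain ⟨x, hxL, hx, hx0⟩ := hv.exists_zeros ∅ (by simp)
  have hne : x ≠ 0 := by
    rintro rfl
    obtain ⟨i⟩ := Fintype.card_pos_iff.1 hcard
    simpa using hx0 i
  have hpos := sum_pos_of_nonneg_of_ne_zero hx hne
  let σ : (ι → ℝ) →ₗ[ℝ] ℝ := ∑ i, LinearMap.proj i
  have hσ : ∀ y, σ y = ∑ i, y i := fun y => by simp [σ, LinearMap.sum_apply]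
  let f : L →ₗ[ℝ] ℝ := σ.comp L.subtype
  have hsurj : Function.Surjective f := LinearMap.surjective fun h0 => by
    have := LinearMap.congr_fun h0 ⟨x, hxL⟩
    simp only [f, LinearMap.comp_apply, Submodule.subtype_apply, hσ, LinearMap.zero_apply] at this
    exact hpos.ne' this
  obtain ⟨e⟩ := nonempty_linearEquiv_ker f hsurj hd
  let p : ι → ℝ := (∑ i, x i)⁻¹ • x
  have hpL : p ∈ L := L.smul_mem _ hxL
  have hp1 : ∑ i, p i = 1 := by
    simp [p, ← Finset.mul_sum, inv_mul_cancel₀ hpos.ne']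
  refine ⟨p, L.subtype.comp ((LinearMap.ker f).subtype.comp e.toLinearMap), ?_, fun u => ?_,
    fun u => ?_, fun y hyL hy => ?_⟩
  · exact (Subtype.val_injective.comp (Subtype.val_injective.comp e.injective))
  · exact L.add_mem hpL (e u).1.2
  · have h0 : f (e u).1 = 0 := (e u).2
    simp only [f, LinearMap.comp_apply, hσ] at h0
    rw [Finset.sum_add_distrib, hp1]
    simpa using h0
  · have hmem : (⟨y - p, L.sub_mem hyL hpL⟩ : L) ∈ LinearMap.ker f := by
      simp [f, hσ, hy, hp1]
    refine ⟨e.symm ⟨_, hmem⟩, ?_⟩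
    simp

end Vertices

/-! ### Joins, pyramids and products of simplices -/

/-- There is a Kirkman cone of dimension `D` with `n` extreme rays. -/
def HasKirkmanCone (D n : ℕ) : Prop :=
  ∃ (ι κ : Type) (_ : Fintype ι) (_ : Fintype κ) (L : Submodule ℝ (ι → ℝ)) (v : κ → ι → ℝ),
    IsKirkmanCone L v ∧ Module.finrank ℝ L = D ∧ Fintype.card κ = n

theorem HasKirkmanCone.exists_isSuperKirkman {d n : ℕ} (h : HasKirkmanCone (d + 1) n)
    (hd : 2 ≤ d) : ∃ P : Set (EuclideanSpace ℝ (Fin d)),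
      IsSuperKirkman P ∧ dim P = d ∧ (vertices P).ncard = n := by
  obtain ⟨ι, κ, _, _, L, v, hv, hL, rfl⟩ := h
  have hcard : d + 1 ≤ Fintype.card ι := by
    have := L.finrank_le
    rwa [hL, Module.finrank_fintype_fun_eq_card] at this
  obtain ⟨p, φ, hφ⟩ := hv.exists_isSliceChart (by omega) hL
  have := hv.isSuperKirkman_slice hφ (by omega)
  rw [finrank_euclideanSpace_fin] at this
  exact ⟨_, this⟩

theorem hasKirkmanCone_one : HasKirkmanCone 1 1 := by
  refine ⟨Unit, Unit, inferInstance, inferInstance, ⊤, fun _ _ => 1, ?_, by simp, by simp⟩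
  refine ⟨by simp, by simp, fun _ h => by simpa using congrFun h (), by simp, ?_, fun s _ i hi => ⟨(), ?_, one_ne_zero⟩⟩
  swap
  · rintro ⟨⟩ hj
    exact absurd hj hi
  rintro x - - hx
  refine ⟨(), fun i _ hi => hx (funext fun j => ?_)⟩
  simpa using hi

/-- The direct sum of two Kirkman cones, which is the cone over the join of the polytopes. -/
theorem HasKirkmanCone.add {D n D' n' : ℕ} (h : HasKirkmanCone D n) (h' : HasKirkmanCone D' n') :
    HasKirkmanCone (D + D') (n + n') := by
  obtain ⟨ι, κ, _, _, L, v, hv, rfl, rfl⟩ := h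
  obtain ⟨ι', κ', _, _, L', v', hv', rfl, rfl⟩ := h'
  let e : (ι ⊕ ι' → ℝ) ≃ₗ[ℝ] (ι → ℝ) × (ι' → ℝ) := LinearEquiv.sumArrowLequivProdArrow ι ι' ℝ ℝ
  let M : Submodule ℝ (ι ⊕ ι' → ℝ) := (L.prod L').comap e.toLinearMap
  have hmem : ∀ x, x ∈ M ↔ (fun i => x (Sum.inl i)) ∈ L ∧ (fun i => x (Sum.inr i)) ∈ L' :=
    fun x => Iff.rfl
  refine ⟨ι ⊕ ι', κ ⊕ κ', inferInstance, inferInstance, M,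
    Sum.elim (fun k => Sum.elim (v k) 0) (fun k => Sum.elim 0 (v' k)), ⟨?_, ?_, ?_, ?_, ?_, ?_⟩,
    ?_, by simp⟩
  · rintro (k | k)
    · exact (hmem _).2 ⟨hv.mem k, L'.zero_mem⟩
    · exact (hmem _).2 ⟨L.zero_mem, hv'.mem k⟩
  · rintro (k | k) (i | i)
    · exact hv.nonneg k i
    · exact le_rfl
    · exact le_rfl
    · exact hv'.nonneg k i
  · rintro (k | k) h0
    · exact hv.ne_zero k (funext fun i => congrFun h0 (Sum.inl i))
    · exact hv'.ne_zero k (funext fun i => congrFun h0 (Sum.inr i))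
  · rintro (k | k) (l | l) hkl
    · exact congrArg _ (hv.antichain k l fun i => hkl (Sum.inl i))
    · exact absurd (funext fun i => by_contra fun hi => hkl (Sum.inl i) hi rfl) (hv.ne_zero k)
    · exact absurd (funext fun i => by_contra fun hi => hkl (Sum.inr i) hi rfl) (hv'.ne_zero k)
    · exact congrArg _ (hv'.antichain k l fun i => hkl (Sum.inr i))
  · intro x hx hx0 hne
    by_cases hl : (fun i => x (Sum.inl i)) = 0
    · obtain ⟨k, hk⟩ := hv'.exists_support_subset _ ((hmem x).1 hx).2 (fun i => hx0 _) fun hr =>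
        hne (funext (Sum.rec (congrFun hl) (congrFun hr)))
      exact ⟨Sum.inr k, Sum.rec (fun i hi => absurd rfl hi) hk⟩
    · obtain ⟨k, hk⟩ := hv.exists_support_subset _ ((hmem x).1 hx).1 (fun i => hx0 _) hl
      exact ⟨Sum.inl k, Sum.rec hk (fun i hi => absurd rfl hi)⟩
  · rintro s hs (i | i) hi
    · obtain ⟨k, hk, hki⟩ := hv.exists_ray s.toLeft (s.card_toLeft_le.trans hs) i (by simpa using hi)
      exact ⟨Sum.inl k, Sum.rec (fun j hj => hk j (by simpa using hj)) (fun j _ => rfl), hki⟩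
    · obtain ⟨k, hk, hki⟩ := hv'.exists_ray s.toRight (s.card_toRight_le.trans hs) i
        (by simpa using hi)
      exact ⟨Sum.inr k, Sum.rec (fun j _ => rfl) (fun j hj => hk j (by simpa using hj)), hki⟩
  · let g : M ≃ₗ[ℝ] L × L' :=
      { toFun := fun x => (⟨_, x.2.1⟩, ⟨_, x.2.2⟩)
        invFun := fun y => ⟨Sum.elim y.1 y.2, y.1.2, y.2.2⟩
        map_add' := fun _ _ => rfl
        map_smul' := fun _ _ => rfl
        left_inv := fun x => Subtype.ext (Sum.elim_comp_inl_inr x.1)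
        right_inv := fun _ => rfl }
    rw [g.finrank_eq, Module.finrank_prod]

/-- Iterated pyramids keep the excess `e`. -/
theorem HasKirkmanCone.of_le {D e D' : ℕ} (h : HasKirkmanCone D (D + e)) (hD : D ≤ D') :
    HasKirkmanCone D' (D' + e) := by
  induction D', hD using Nat.le_induction with
  | base => exact h
  | succ m _ ih =>
    have := ih.add hasKirkmanCone_one
    rwa [add_right_comm] at this

/-- The cone over a product of two simplices. -/
theorem hasKirkmanCone_prod (a b : ℕ) (ha : 2 ≤ a) (hb : 2 ≤ b) :
    HasKirkmanCone (a + b + 1) ((a + 1) * (b + 1)) := by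
  classical
  let f : (Fin (a + 1) ⊕ Fin (b + 1) → ℝ) →ₗ[ℝ] ℝ :=
    ∑ i, LinearMap.proj (Sum.inl i) - ∑ j, LinearMap.proj (Sum.inr j)
  have hf : ∀ x, f x = ∑ i, x (Sum.inl i) - ∑ j, x (Sum.inr j) := fun x => by
    simp [f, LinearMap.sum_apply]
  let v : Fin (a + 1) × Fin (b + 1) → Fin (a + 1) ⊕ Fin (b + 1) → ℝ := fun k =>
    Sum.elim (Pi.single k.1 1) (Pi.single k.2 1)
  have hvl : ∀ k i, v k (Sum.inl i) = if i = k.1 then 1 else 0 := fun k i => by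
    simp [v, Pi.single_apply]
  have hvr : ∀ k j, v k (Sum.inr j) = if j = k.2 then 1 else 0 := fun k i => by
    simp [v, Pi.single_apply]
  refine ⟨_, _, inferInstance, inferInstance, LinearMap.ker f, v, ⟨?_, ?_, ?_, ?_, ?_, ?_⟩, ?_,
    by simp⟩
  · intro k
    simp [hf, hvl, hvr]
  · rintro k (i | i)
    · rw [hvl]; positivity
    · rw [hvr]; positivity
  · intro k h0
    simpa [hvl] using congrFun h0 (Sum.inl k.1)
  · intro k l hkl
    have h1 := hkl (Sum.inl k.1)
    have h2 := hkl (Sum.inr k.2)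
    simp only [hvl, hvr, if_true, ne_eq, one_ne_zero, not_false_eq_true, ite_eq_right_iff,
      imp_false, not_not, forall_const] at h1 h2
    exact Prod.ext h1 h2
  · intro x hx hx0 hne
    have hsum : ∑ i, x (Sum.inl i) = ∑ j, x (Sum.inr j) := by
      rwa [LinearMap.mem_ker, hf, sub_eq_zero] at hx
    have hl : ∃ i, x (Sum.inl i) ≠ 0 := by
      by_contra! h0
      rw [Finset.sum_eq_zero fun i _ => h0 i, eq_comm,
        Finset.sum_eq_zero_iff_of_nonneg fun j _ => hx0 _] at hsum
      exact hne (funext (Sum.rec h0 fun j => hsum j (Finset.mem_univ j)))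
    have hr : ∃ j, x (Sum.inr j) ≠ 0 := by
      by_contra! h0
      rw [Finset.sum_eq_zero (s := Finset.univ) (f := fun j => x (Sum.inr j)) fun i _ => h0 i,
        Finset.sum_eq_zero_iff_of_nonneg fun j _ => hx0 _] at hsum
      exact hne (funext (Sum.rec (fun i => hsum i (Finset.mem_univ i)) h0))
    obtain ⟨i, hi⟩ := hl
    obtain ⟨j, hj⟩ := hr
    refine ⟨(i, j), Sum.rec (fun i' h0 => ?_) (fun j' h0 => ?_)⟩
    · simp only [hvl, ne_eq, ite_eq_right_iff, one_ne_zero, imp_false, not_not] at h0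
      rwa [h0]
    · simp only [hvr, ne_eq, ite_eq_right_iff, one_ne_zero, imp_false, not_not] at h0
      rwa [h0]
  · intro s hs
    -- Since `2 ≤ a`, two coordinates cannot exhaust the `a + 1` on this side; the other side uses
    -- `2 ≤ b`.
    have hleft : ∃ i, Sum.inl i ∉ s := by
      by_contra! h0
      have h1 : s.toLeft = Finset.univ := Finset.eq_univ_iff_forall.2 fun i => by simpa using h0 i
      have := s.card_toLeft_le
      rw [h1, Finset.card_univ, Fintype.card_fin] at this
      omega
    have hright : ∃ j, Sum.inr j ∉ s := by
      by_contra! h0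
      have h1 : s.toRight = Finset.univ := Finset.eq_univ_iff_forall.2 fun i => by simpa using h0 i
      have := s.card_toRight_le
      rw [h1, Finset.card_univ, Fintype.card_fin] at this
      omega
    have key : ∀ i j, Sum.inl i ∉ s → Sum.inr j ∉ s → ∀ t ∈ s, v (i, j) t = 0 := by
      rintro i j hi hj (t | t) ht
      · rw [hvl, if_neg]
        rintro rfl
        exact hi ht
      · rw [hvr, if_neg]
        rintro rfl
        exact hj ht
    obtain ⟨i₀, hi₀⟩ := hleft
    obtain ⟨j₀, hj₀⟩ := hright
    rintro (i | j) hi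
    · exact ⟨(i, j₀), key i j₀ hi hj₀, by simp [hvl]⟩
    · exact ⟨(i₀, j), key i₀ j hi₀ hi, by simp [hvr]⟩
  · have hsurj : Function.Surjective f := LinearMap.surjective fun h0 => by
      have := LinearMap.congr_fun h0 (Pi.single (Sum.inl 0) 1)
      simp [hf, Pi.single_apply] at this
    have := f.finrank_range_add_finrank_ker
    rw [LinearMap.range_eq_top.2 hsurj, finrank_top, Module.finrank_self,
      Module.finrank_fintype_fun_eq_card, Fintype.card_sum, Fintype.card_fin, Fintype.card_fin]
      at this
    omega

/-! ### The sporadic cone of excess 7 -/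

/-- The extreme rays of the sporadic cone. -/
def sporadicRay : Fin 14 → Fin 10 → ℕ :=
  ![![1, 1, 0, 0, 0, 0, 0, 0, 0, 0],
    ![0, 0, 1, 1, 0, 0, 0, 0, 0, 0],
    ![0, 0, 0, 0, 0, 0, 1, 1, 0, 0],
    ![0, 0, 1, 0, 1, 0, 0, 0, 1, 0],
    ![0, 0, 0, 1, 0, 1, 0, 0, 0, 1],
    ![0, 1, 0, 0, 1, 0, 0, 0, 0, 1],
    ![1, 0, 0, 0, 0, 1, 0, 0, 1, 0],
    ![0, 0, 0, 0, 0, 0, 2, 0, 1, 1],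
    ![0, 0, 0, 0, 1, 1, 0, 2, 0, 0],
    ![0, 0, 0, 0, 1, 1, 0, 0, 1, 1],
    ![1, 0, 0, 1, 0, 2, 0, 2, 0, 0],
    ![0, 1, 1, 0, 2, 0, 0, 2, 0, 0],
    ![1, 0, 1, 0, 0, 0, 2, 0, 2, 0],
    ![0, 1, 0, 1, 0, 0, 2, 0, 0, 2]]

/-- The linear equations of the sporadic cone. -/
def sporadicMap : (Fin 10 → ℝ) →ₗ[ℝ] ℝ × ℝ × ℝ where
  toFun x := (2 * x 0 + 2 * x 4 + x 6 - (2 * x 1 + x 7 + 2 * x 8),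
    2 * x 1 + 2 * x 5 + x 6 - (2 * x 0 + x 7 + 2 * x 9),
    2 * x 2 + x 5 + x 9 - (2 * x 3 + x 4 + x 8))
  map_add' x y := by
    simp only [Pi.add_apply, Prod.mk_add_mk, Prod.mk.injEq]
    refine ⟨?_, ?_, ?_⟩ <;> ring
  map_smul' c x := by
    simp only [Pi.smul_apply, smul_eq_mul, RingHom.id_apply, Prod.smul_mk, Prod.mk.injEq]
    refine ⟨?_, ?_, ?_⟩ <;> ring

theorem mem_ker_sporadicMap {x : Fin 10 → ℝ} : x ∈ LinearMap.ker sporadicMap ↔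
    2 * x 0 + 2 * x 4 + x 6 = 2 * x 1 + x 7 + 2 * x 8 ∧
    2 * x 1 + 2 * x 5 + x 6 = 2 * x 0 + x 7 + 2 * x 9 ∧
    2 * x 2 + x 5 + x 9 = 2 * x 3 + x 4 + x 8 := by
  simp [sporadicMap, sub_eq_zero]

theorem surjective_sporadicMap : Function.Surjective sporadicMap := by
  rintro ⟨a, b, c⟩
  refine ⟨![0, 0, (c + a / 2 - b / 2) / 2, 0, a / 2, b / 2, 0, 0, 0, 0], ?_⟩
  simp only [sporadicMap, LinearMap.coe_mk, AddHom.coe_mk, Prod.mk.injEq, Matrix.cons_val]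
  refine ⟨?_, ?_, ?_⟩ <;> ring

/-- The support patterns compatible with the signs in the equations contain a ray. -/
theorem exists_sporadicRay_of_pattern : ∀ b₀ b₁ b₂ b₃ b₄ b₅ b₆ b₇ b₈ b₉ : Bool,
    (b₀ || b₄ || b₆) = (b₁ || b₇ || b₈) → (b₁ || b₅ || b₆) = (b₀ || b₇ || b₉) →
    (b₂ || b₅ || b₉) = (b₃ || b₄ || b₈) →
    (b₀ || b₁ || b₂ || b₃ || b₄ || b₅ || b₆ || b₇ || b₈ || b₉) = true →
    ∃ k, ∀ i, sporadicRay k i ≠ 0 → ![b₀, b₁, b₂, b₃, b₄, b₅, b₆, b₇, b₈, b₉] i = true := by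
  decide +kernel

/-- For nonnegative entries, the two sides of each equation vanish together. This Boolean shadow of
the equations already forces a ray's support, so a check of the 0-1 patterns suffices. -/
theorem exists_sporadicRay_of_mem_ker {x : Fin 10 → ℝ} (hx : x ∈ LinearMap.ker sporadicMap)
    (h0 : ∀ i, 0 ≤ x i) (hne : x ≠ 0) : ∃ k, ∀ i, sporadicRay k i ≠ 0 → x i ≠ 0 := by
  obtain ⟨h1, h2, h3⟩ := mem_ker_sporadicMap.1 hx
  have key : ∀ {p q r p' q' r' : ℝ}, 0 ≤ p → 0 ≤ q → 0 ≤ r → 0 ≤ p' → 0 ≤ q' → 0 ≤ r' →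
      p + q + r = p' + q' + r' → ((p ≠ 0 ∨ q ≠ 0) ∨ r ≠ 0 ↔ (p' ≠ 0 ∨ q' ≠ 0) ∨ r' ≠ 0) := by
    intro p q r p' q' r' hp hq hr hp' hq' hr' h
    rw [← not_iff_not]
    push Not
    constructor
    · rintro ⟨⟨rfl, rfl⟩, rfl⟩
      refine ⟨⟨?_, ?_⟩, ?_⟩ <;> linarith
    · rintro ⟨⟨rfl, rfl⟩, rfl⟩
      refine ⟨⟨?_, ?_⟩, ?_⟩ <;> linarith
  have h1' := key (by linarith [h0 0]) (by linarith [h0 4]) (h0 6) (by linarith [h0 1]) (h0 7)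
    (by linarith [h0 8]) h1
  have h2' := key (by linarith [h0 1]) (by linarith [h0 5]) (h0 6) (by linarith [h0 0]) (h0 7)
    (by linarith [h0 9]) h2
  have h3' := key (by linarith [h0 2]) (h0 5) (h0 9) (by linarith [h0 3]) (h0 4) (h0 8) h3
  simp only [ne_eq, mul_eq_zero, OfNat.ofNat_ne_zero, false_or] at h1' h2' h3'
  obtain ⟨b, hb⟩ : ∃ b : Fin 10 → Bool, ∀ i, b i = true ↔ ¬x i = 0 :=
    ⟨fun i => decide (¬x i = 0), fun i => decide_eq_true_iff⟩
  obtain ⟨k, hk⟩ := exists_sporadicRay_of_pattern (b 0) (b 1) (b 2) (b 3) (b 4) (b 5) (b 6) (b 7)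
    (b 8) (b 9) (Bool.eq_iff_iff.2 (by simpa only [Bool.or_eq_true, hb] using h1'))
    (Bool.eq_iff_iff.2 (by simpa only [Bool.or_eq_true, hb] using h2'))
    (Bool.eq_iff_iff.2 (by simpa only [Bool.or_eq_true, hb] using h3')) (by
      by_contra hcon
      simp only [Bool.or_eq_true, hb, not_or, not_not] at hcon
      obtain ⟨⟨⟨⟨⟨⟨⟨⟨⟨c0, c1⟩, c2⟩, c3⟩, c4⟩, c5⟩, c6⟩, c7⟩, c8⟩, c9⟩ := hcon
      refine hne (funext fun i => ?_)
      fin_cases i <;> assumption)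
  have hvec : ![b 0, b 1, b 2, b 3, b 4, b 5, b 6, b 7, b 8, b 9] = b := by
    funext i
    fin_cases i <;> rfl
  rw [hvec] at hk
  exact ⟨k, fun i hi => (hb i).1 (hk i hi)⟩

theorem exists_sporadicRay_of_ne : ∀ j j' i, i ≠ j → i ≠ j' →
    ∃ k, sporadicRay k j = 0 ∧ sporadicRay k j' = 0 ∧ sporadicRay k i ≠ 0 := by
  decide +kernel

theorem sporadicRay_antichain :
    ∀ k l, (∀ i, sporadicRay k i ≠ 0 → sporadicRay l i ≠ 0) → k = l := by
  decide +kernel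

theorem sporadicRay_equations : ∀ k,
    2 * sporadicRay k 0 + 2 * sporadicRay k 4 + sporadicRay k 6 =
      2 * sporadicRay k 1 + sporadicRay k 7 + 2 * sporadicRay k 8 ∧
    2 * sporadicRay k 1 + 2 * sporadicRay k 5 + sporadicRay k 6 =
      2 * sporadicRay k 0 + sporadicRay k 7 + 2 * sporadicRay k 9 ∧
    2 * sporadicRay k 2 + sporadicRay k 5 + sporadicRay k 9 =
      2 * sporadicRay k 3 + sporadicRay k 4 + sporadicRay k 8 := by
  decide +kernel

/-- The cone over a six-dimensional super-Kirkman polytope with ten facets and fourteen vertices. -/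
theorem hasKirkmanCone_sporadic : HasKirkmanCone 7 14 := by
  classical
  refine ⟨Fin 10, Fin 14, inferInstance, inferInstance, LinearMap.ker sporadicMap,
    fun k i => (sporadicRay k i : ℝ), ⟨?_, ?_, ?_, ?_, ?_, ?_⟩, ?_, by simp⟩
  · intro k
    rw [mem_ker_sporadicMap]
    exact_mod_cast sporadicRay_equations k
  · intro k i
    positivity
  · have h : ∀ k, ∃ i, sporadicRay k i ≠ 0 := by decide +kernel
    intro k hk
    obtain ⟨i, hi⟩ := h k
    exact hi (Nat.cast_eq_zero.1 (congrFun hk i))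
  · intro k l hkl
    exact sporadicRay_antichain k l (by exact_mod_cast hkl)
  · intro x hx h0 hne
    obtain ⟨k, hk⟩ := exists_sporadicRay_of_mem_ker hx h0 hne
    exact ⟨k, by exact_mod_cast hk⟩
  · intro s hs i hi
    -- Enlarge `s` to exactly two coordinates avoiding `i`, the form checked by
    -- `exists_sporadicRay_of_ne`.
    obtain ⟨j, j', hj, hj', hsub⟩ : ∃ j j', i ≠ j ∧ i ≠ j' ∧ s ⊆ {j, j'} := by
      obtain ⟨t, hst, ht⟩ := Finset.exists_subsuperset_card_eq (n := 2)
        (show s ⊆ Finset.univ.erase i from fun j hj => by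
          simpa using fun h : j = i => hi (h ▸ hj)) hs (by simp)
      obtain ⟨j, j', -, rfl⟩ := Finset.card_eq_two.1 ht.2
      refine ⟨j, j', fun h => ?_, fun h => ?_, hst⟩
      · exact Finset.ne_of_mem_erase (ht.1 (show j ∈ {j, j'} by simp)) h.symm
      · exact Finset.ne_of_mem_erase (ht.1 (show j' ∈ {j, j'} by simp)) h.symm
    obtain ⟨k, hkj, hkj', hki⟩ := exists_sporadicRay_of_ne j j' i hj hj'
    refine ⟨k, fun l hl => ?_, by exact_mod_cast hki⟩
    rcases Finset.mem_insert.1 (hsub hl) with rfl | hl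
    · exact_mod_cast hkj
    · rw [Finset.mem_singleton.1 hl]
      exact_mod_cast hkj'
  · have := sporadicMap.finrank_range_add_finrank_ker
    rw [LinearMap.range_eq_top.2 surjective_sporadicMap, finrank_top, Module.finrank_prod,
      Module.finrank_prod, Module.finrank_self, Module.finrank_fintype_fun_eq_card,
      Fintype.card_fin] at this
    omega

/-! ### Realizing every excess -/

theorem exists_hasKirkmanCone (e : ℕ) (he : 6 ≤ e) : ∃ D, HasKirkmanCone D (D + e) := by
  have h4 : HasKirkmanCone 5 9 := hasKirkmanCone_prod 2 2 le_rfl le_rfl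
  induction e using Nat.strong_induction_on with
  | _ e ih =>
    by_cases h : e < 10
    -- The excesses are 2 · 3, the sporadic 7, 4 + 4 and 3 · 3: four consecutive base values for
    -- steps of 4.
    · interval_cases e
      · exact ⟨6, hasKirkmanCone_prod 2 3 (by norm_num) (by norm_num)⟩
      · exact ⟨7, hasKirkmanCone_sporadic⟩
      · exact ⟨10, h4.add h4⟩
      · exact ⟨7, hasKirkmanCone_prod 3 3 (by norm_num) (by norm_num)⟩
    · obtain ⟨D, hD⟩ := ih (e - 4) (by omega) (by omega)
      refine ⟨D + 5, ?_⟩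
      have := hD.add h4
      rwa [show D + (e - 4) + 9 = D + 5 + e by omega] at this

end Polytope

theorem mainTheorem10 (k : ℕ) (hk : 7 ≤ k) :
    ∃ d₀ : ℕ, ∀ d : ℕ, d₀ ≤ d →
      ∃ P : Set (EuclideanSpace ℝ (Fin d)),
        Polytope.IsSuperKirkman P ∧ Polytope.dim P = d ∧
          (Polytope.vertices P).ncard = d + k := by
  -- The cone over a `d`-polytope has dimension `d + 1`, so `d + k` vertices mean excess `k - 1`.
  -- The `+ 2` in the bound below guarantees `2 ≤ d`.
  obtain ⟨D, hD⟩ := Polytope.exists_hasKirkmanCone (k - 1) (by omega)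
  refine ⟨D + 2, fun d hd => Polytope.HasKirkmanCone.exists_isSuperKirkman ?_ (by omega)⟩
  have := hD.of_le (show D ≤ d + 1 by omega)
  rwa [show d + 1 + (k - 1) = d + k by omega] at this
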